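/- Let $X$ be a finite set of $m$ variables. Well-formed formulae over $X$ are built from the variables by negation $\neg\phi$ and implication $\phi\to\psi$; their length is defined by $\ell(x)=1$ for a variable $x$, $\ell(\neg\phi)=\ell(\phi)+1$ and $\ell(\phi\to\psi)=\ell(\phi)+\ell(\psi)+1$. The generating function of a set $\mathcal S$ of formulae is the formal power series $\sum_{\phi\in\mathcal S}z^{\ell(\phi)}$, and $W(z)$ denotes the generating function of all formulae. For formulae $\psi_1,\dots,\psi_k$ with $k\ge 1$ and a variable $p$, write $\psi_1,\dots,\psi_k\mapsto p$ for the formula $\psi_1\to(\psi_2\to(\cdots\to(\psi_k\to p)\cdots))$. This formula is a simple tautology of the first kind if $\psi_i=p$ for some $i$; it is a strict simple tautology of the first kind if $\psi_1=p$ and $\psi_i\ne p$ for all $2\le i\le k$. Let $S_1(z)$ and $S_c(z)$ be the generating functions of the simple tautologies of the first kind and of the strict ones, respectively. (a) We have $$S_1(z)=\frac{mz^3}{(1+z^2-zW(z))(1-zW(z))},$$ and, if $m\ge 1$, $$\lim_{n\to\infty}\frac{[z^n]S_1(z)}{[z^n]W(z)}=\frac{m(4m+6\sqrt m+3)}{(\sqrt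 m+1)^2(2m+3\sqrt m+2)^2};$$ as $m\to\infty$, this limit is $$\frac1m-\frac{7}{2m\sqrt m}+\frac{7}{m^2}+O\!\left(\frac{1}{m^2\sqrt m}\right).$$ (b) We have $$S_c(z)=\frac{mz^3}{1+z^2-zW(z)},$$ and, if $m\ge 1$, $$\lim_{n\to\infty}\frac{[z^n]S_c(z)}{[z^n]W(z)}=\frac{m}{(2m+3\sqrt m+2)^2};$$ as $m\to\infty$, this limit is $$\frac1{4m}-\frac{3}{4m\sqrt m}+\frac{19}{16m^2}+O\!\left(\frac{1}{m^2\sqrt m}\right).$$ -/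

import Mathlib

universe u

open Filter Asymptotics

/-- Well-formed formulae over a set `X` of variables, with negation and implication. -/
inductive Wff (X : Type*) where
  | var : X → Wff X
  | neg : Wff X → Wff X
  | imp : Wff X → Wff X → Wff X

namespace Wff

variable {X : Type*}

/-- The length of a formula: the number of variables, negations and implications in it,
counted with multiplicity. -/
def length : Wff X → ℕ
  | var _ => 1
  | neg φ => length φ + 1
  | imp φ ψ => length φ + length ψ + 1

theorem length_pos (φ : Wff X) : 0 < φ.length := by
  cases φ <;> simp [length]

/-- There are finitely many formulae of each length, so the cardinalities in
`Wff.genFun` below are cardinalities of finite sets. -/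
theorem finite_length_le [Finite X] (n : ℕ) : {φ : Wff X | φ.length ≤ n}.Finite := by
  induction n with
  | zero =>
    convert Set.finite_empty
    ext φ
    simpa using (length_pos φ).ne'
  | succ n ih =>
    refine (((Set.finite_range (var : X → Wff X)).union (ih.image neg)).union
      (Set.Finite.image2 imp ih ih)).subset ?_
    intro φ hφ
    cases φ with
    | var x => exact Or.inl (Or.inl ⟨x, rfl⟩)
    | neg φ =>
      have h : φ.length + 1 ≤ n + 1 := hφ
      exact Or.inl (Or.inr ⟨φ, Nat.le_of_succ_le_succ h, rfl⟩)
    | imp φ ψ =>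
      have h : φ.length + ψ.length + 1 ≤ n + 1 := hφ
      refine Or.inr ⟨φ, ?_, ψ, ?_, rfl⟩ <;> simp only [Set.mem_ofPred_eq] <;> omega

/-- The canonical form `ψ₁, …, ψₖ ↦ p`, that is, `ψ₁ → (ψ₂ → (⋯ → (ψₖ → p)))`. -/
def chain (ψs : List (Wff X)) (p : X) : Wff X :=
  ψs.foldr imp (var p)

/-- The simple tautologies of the first kind: `ψ₁, …, ψₖ ↦ p` where some `ψᵢ` is `p`
(in particular `k ≥ 1`). -/
def simpleFirst (X : Type*) : Set (Wff X) :=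
  {φ | ∃ (ψs : List (Wff X)) (p : X), var p ∈ ψs ∧ φ = chain ψs p}

/-- The strict simple tautologies of the first kind: `p, ψ₂, …, ψₖ ↦ p` where none of
`ψ₂, …, ψₖ` is `p`; here `k ≥ 1`. -/
def simpleFirstStrict (X : Type*) : Set (Wff X) :=
  {φ | ∃ (ψs : List (Wff X)) (p : X), var p ∉ ψs ∧ φ = chain (var p :: ψs) p}

/-- The generating function of a set `S` of formulae, as a formal power series: the coefficient
of `z ^ n` is the number of formulae of length `n` in `S`. -/
noncomputable def genFun (S : Set (Wff X)) : PowerSeries ℝ :=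
  PowerSeries.mk fun n => ({φ | φ ∈ S ∧ φ.length = n}.ncard : ℝ)

/-- `S` has limiting density `d`: the proportion of elements of `S` among all formulae of
length `n` tends to `d` as `n → ∞`. -/
def HasDensity (S : Set (Wff X)) (d : ℝ) : Prop :=
  Tendsto (fun n : ℕ => PowerSeries.coeff n (genFun S) /
    PowerSeries.coeff n (genFun (Set.univ : Set (Wff X)))) atTop (nhds d)

end Wff

/-- The closed form of the limiting density of simple tautologies of the first kind. -/
noncomputable def densityFirst (m : ℕ) : ℝ :=
  m * (4 * m + 6 * √(m : ℝ) + 3) / ((√(m : ℝ) + 1) ^ 2 * (2 * m + 3 * √(m : ℝ) + 2) ^ 2)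

/-- The closed form of the limiting density of strict simple tautologies of the first kind. -/
noncomputable def densityFirstStrict (m : ℕ) : ℝ :=
  m / (2 * m + 3 * √(m : ℝ) + 2) ^ 2

/-! Generating functions. A canonical form is determined by its premises and its target `p`. Let C
count all canonical forms and F those without `p` among the premises. Prefixing a premise gives C =
mz + zWC. Prefixing one to a form counted by F gives another such form, or a strict tautology if the
premise is `p`, so F + S_c = mz + zWF. Since S_c = z²F and S₁ = C - F, the closed forms follow by
algebra.

Densities, without complex analysis. Put s = √m. The quadratic equation for W reads (1 - z - 2zW)² =
(1 - (1+2s)z)(1 + (2s-1)z), and differentiating gives a three-term recurrence (`recurrence`) for the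
coefficients w_n, whose leading-order characteristic roots are 1+2s and -(2s-1). The combination d_n
= w_{n+1} + (2s-1)w_n (`dominant`) follows the first root, and w_{n+1} - (1+2s)w_n is o(d_n)
(`tendsto_error`). Hence d_{n+1}/d_n → 1+2s and w_n/d_n → 1/(4s). At r = 1/(1+2s) the series W
converges, to s (`sumsTo`).

For V = zW or V = zW - z², the inverse P = 1/(1-V) satisfies zP' = P²·zV', that is, nP_n = Σ (P²)_i
· jV_j over i + j = n. The weight j favours large j, so `tendsto_weighted_convolution` needs the
asymptotics of V_j but only the bound (P²)_i ≤ d_i. The outcome is P_n/w_n → r/(1-V(r))²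
(`tendsto_coeff_inv_div`), and both densities are combinations of such limits. -/

namespace Wff

variable {X : Type*}

/-! ### Generating functions of unions, images and implications -/

theorem finite_length_eq [Finite X] (S : Set (Wff X)) (n : ℕ) :
    {φ | φ ∈ S ∧ φ.length = n}.Finite :=
  (finite_length_le n).subset fun _ h => h.2.le

theorem coeff_genFun (S : Set (Wff X)) (n : ℕ) :
    PowerSeries.coeff n (genFun S) = ({φ | φ ∈ S ∧ φ.length = n}.ncard : ℝ) := by
  simp [genFun]

theorem coeff_genFun_nonneg (S : Set (Wff X)) (n : ℕ) :
    0 ≤ PowerSeries.coeff n (genFun S) := by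
  rw [coeff_genFun]; positivity

theorem genFun_union [Finite X] {S T : Set (Wff X)} (h : Disjoint S T) :
    genFun (S ∪ T) = genFun S + genFun T := by
  ext n
  rw [map_add, coeff_genFun, coeff_genFun, coeff_genFun]
  have : {φ | φ ∈ S ∪ T ∧ φ.length = n} =
      {φ | φ ∈ S ∧ φ.length = n} ∪ {φ | φ ∈ T ∧ φ.length = n} := by
    ext φ; simp only [Set.mem_union, Set.mem_ofPred_eq]; tauto
  rw [this, Set.ncard_union_eq _ (finite_length_eq S n) (finite_length_eq T n)]
  · push_cast; rfl
  · exact h.mono (fun _ h => h.1) (fun _ h => h.1)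

theorem genFun_image (S : Set (Wff X)) (f : Wff X → Wff X) (k : ℕ)
    (hf : Set.InjOn f S) (hk : ∀ φ ∈ S, (f φ).length = φ.length + k) :
    genFun (f '' S) = PowerSeries.X ^ k * genFun S := by
  ext n
  rw [PowerSeries.coeff_X_pow_mul', coeff_genFun]
  split_ifs with h
  · rw [coeff_genFun]
    have : {φ | φ ∈ f '' S ∧ φ.length = n} = f '' {φ | φ ∈ S ∧ φ.length = n - k} := by
      ext φ
      constructor
      · rintro ⟨⟨ψ, hψ, rfl⟩, h2⟩
        have := hk ψ hψ
        exact ⟨ψ, ⟨hψ, by omega⟩, rfl⟩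
      · rintro ⟨ψ, ⟨hψ, h2⟩, rfl⟩
        have := hk ψ hψ
        exact ⟨⟨ψ, hψ, rfl⟩, by omega⟩
    rw [this, (hf.mono fun _ h => h.1).ncard_image]
  · have : {φ | φ ∈ f '' S ∧ φ.length = n} = ∅ := by
      rw [Set.eq_empty_iff_forall_notMem]
      rintro _ ⟨⟨ψ, hψ, rfl⟩, h2⟩
      have := hk ψ hψ
      omega
    rw [this]; simp

theorem genFun_range_var [Finite X] :
    genFun (Set.range (var : X → Wff X)) = (Nat.card X : PowerSeries ℝ) * PowerSeries.X := by
  ext n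
  rw [coeff_genFun, ← map_natCast (PowerSeries.C (R := ℝ)), PowerSeries.coeff_C_mul,
    PowerSeries.coeff_X]
  split_ifs with h
  · have : {φ | φ ∈ Set.range (var : X → Wff X) ∧ φ.length = n} = Set.range var := by
      ext φ
      simp only [Set.mem_ofPred_eq, and_iff_left_iff_imp]
      rintro ⟨x, rfl⟩
      simp [length, h]
    rw [this, ← Nat.card_coe_set_eq, Nat.card_range_of_injective (fun a b h => by simpa using h)]
    simp
  · have : {φ | φ ∈ Set.range (var : X → Wff X) ∧ φ.length = n} = ∅ := by
      rw [Set.eq_empty_iff_forall_notMem]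
      rintro _ ⟨⟨x, rfl⟩, h2⟩
      simp only [length] at h2
      omega
    rw [this]; simp

theorem genFun_image2_imp [Finite X] (S T : Set (Wff X)) :
    genFun (Set.image2 imp S T) = PowerSeries.X * (genFun S * genFun T) := by
  classical
  ext n
  cases n with
  | zero =>
    rw [PowerSeries.coeff_zero_X_mul, coeff_genFun]
    have : {φ | φ ∈ Set.image2 imp S T ∧ φ.length = 0} = ∅ := by
      rw [Set.eq_empty_iff_forall_notMem]
      rintro φ ⟨-, h2⟩
      exact (length_pos φ).ne' h2
    rw [this]; simp
  | succ n =>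
    rw [PowerSeries.coeff_succ_X_mul, PowerSeries.coeff_mul, coeff_genFun]
    let A (S : Set (Wff X)) (i : ℕ) : Finset (Wff X) := (finite_length_eq S i).toFinset
    have key : {φ | φ ∈ Set.image2 imp S T ∧ φ.length = n + 1} =
        (((Finset.HasAntidiagonal.antidiagonal n).biUnion fun p => (A S p.1 ×ˢ A T p.2).image
          fun q => imp q.1 q.2 : Finset (Wff X)) : Set (Wff X)) := by
      ext φ
      simp only [A, Set.mem_ofPred_eq, Finset.coe_biUnion, Set.mem_iUnion, Finset.mem_coe,
        Finset.mem_image, Finset.mem_product, Set.Finite.mem_toFinset, Finset.HasAntidiagonal.mem_antidiagonal,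
        Prod.exists, exists_prop]
      constructor
      · rintro ⟨⟨a, ha, b, hb, rfl⟩, h⟩
        have h : a.length + b.length + 1 = n + 1 := h
        exact ⟨a.length, b.length, by omega, a, b, ⟨⟨ha, rfl⟩, hb, rfl⟩, rfl⟩
      · rintro ⟨i, j, hij, a, b, ⟨⟨ha, rfl⟩, hb, rfl⟩, rfl⟩
        exact ⟨⟨a, ha, b, hb, rfl⟩, by simp only [length]; omega⟩
    have hinj : Function.Injective fun q : Wff X × Wff X => imp q.1 q.2 := by
      rintro ⟨a, b⟩ ⟨c, d⟩ h
      simpa using h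
    rw [key, Set.ncard_coe_finset, Finset.card_biUnion]
    · push_cast
      refine Finset.sum_congr rfl fun p _ => ?_
      rw [Finset.card_image_of_injective _ hinj, Finset.card_product, coeff_genFun, coeff_genFun,
        Set.ncard_eq_toFinset_card _ (finite_length_eq S p.1),
        Set.ncard_eq_toFinset_card _ (finite_length_eq T p.2)]
      push_cast; rfl
    · rintro ⟨i, j⟩ - ⟨k, l⟩ - hne
      refine Finset.disjoint_left.2 ?_
      simp only [A, Finset.mem_image, Finset.mem_product, Set.Finite.mem_toFinset, Prod.exists,
        Set.mem_ofPred_eq]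
      rintro _ ⟨a, b, ⟨⟨-, rfl⟩, -, rfl⟩, rfl⟩ ⟨c, d, ⟨⟨-, rfl⟩, -, rfl⟩, h⟩
      have := hinj (a₁ := (c, d)) (a₂ := (a, b)) h
      simp only [Prod.mk.injEq] at this
      obtain ⟨rfl, rfl⟩ := this
      exact hne rfl

theorem disjoint_range_var_image2_imp (S T : Set (Wff X)) :
    Disjoint (Set.range var) (Set.image2 imp S T) := by
  rw [Set.disjoint_left]
  rintro _ ⟨x, rfl⟩ ⟨a, -, b, -, h⟩
  cases h

theorem genFun_univ [Finite X] :
    genFun (Set.univ : Set (Wff X)) = (Nat.card X : PowerSeries ℝ) * PowerSeries.X +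
      PowerSeries.X * genFun (Set.univ : Set (Wff X)) +
      PowerSeries.X * genFun (Set.univ : Set (Wff X)) ^ 2 := by
  have h1 : (Set.univ : Set (Wff X)) =
      (Set.range var ∪ Set.image2 imp Set.univ Set.univ) ∪ neg '' Set.univ := by
    symm
    rw [Set.eq_univ_iff_forall]
    intro φ
    cases φ with
    | var x => exact Or.inl (Or.inl ⟨x, rfl⟩)
    | neg φ => exact Or.inr ⟨φ, trivial, rfl⟩
    | imp φ ψ => exact Or.inl (Or.inr ⟨φ, trivial, ψ, trivial, rfl⟩)
  have h2 : Disjoint (Set.range var ∪ Set.image2 imp Set.univ Set.univ)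
      (neg '' (Set.univ : Set (Wff X))) := by
    rw [Set.disjoint_left]
    rintro _ (⟨x, rfl⟩ | ⟨a, -, b, -, rfl⟩) ⟨c, -, h⟩ <;> cases h
  conv_lhs => rw [h1]
  rw [genFun_union h2, genFun_union (disjoint_range_var_image2_imp _ _), genFun_range_var,
    genFun_image2_imp, genFun_image _ neg 1 (fun a _ b _ h => by simpa using h)
      (fun _ _ => rfl)]
  ring

/-! ### Canonical forms and the closed forms of S₁ and S_c -/

theorem chain_cons (ψ : Wff X) (ψs : List (Wff X)) (p : X) :
    chain (ψ :: ψs) p = imp ψ (chain ψs p) := rfl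

/-- A variable is never an implication, so unwinding the right spine stops at the same place on both
sides. This makes the classes of canonical forms below disjoint. -/
theorem chain_injective {ψs ψs' : List (Wff X)} {p p' : X} (h : chain ψs p = chain ψs' p') :
    ψs = ψs' ∧ p = p' := by
  induction ψs generalizing ψs' with
  | nil =>
    cases ψs' with
    | nil => exact ⟨rfl, by simpa [chain] using h⟩
    | cons a l => cases h
  | cons a l ih =>
    cases ψs' with
    | nil => cases h
    | cons b l' =>
      rw [chain_cons, chain_cons] at h
      injection h with h1 h2
      obtain ⟨h3, h4⟩ := ih h2
      exact ⟨by rw [h1, h3], h4⟩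

/-- All formulae in canonical form `ψ₁, …, ψₖ ↦ p`, with `k ≥ 0`. -/
def chains (X : Type*) : Set (Wff X) :=
  {φ | ∃ (ψs : List (Wff X)) (p : X), φ = chain ψs p}

/-- The formulae `ψ₁, …, ψₖ ↦ p`, with `k ≥ 0`, where no `ψᵢ` is `p`. -/
def freeChains (X : Type*) : Set (Wff X) :=
  {φ | ∃ (ψs : List (Wff X)) (p : X), var p ∉ ψs ∧ φ = chain ψs p}

theorem genFun_chains [Finite X] :
    genFun (chains X) = (Nat.card X : PowerSeries ℝ) * PowerSeries.X +
      PowerSeries.X * (genFun (Set.univ : Set (Wff X)) * genFun (chains X)) := by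
  have h : chains X = Set.range var ∪ Set.image2 imp Set.univ (chains X) := by
    ext φ
    constructor
    · rintro ⟨ψs, p, rfl⟩
      cases ψs with
      | nil => exact Or.inl ⟨p, rfl⟩
      | cons ψ l => exact Or.inr ⟨ψ, trivial, chain l p, ⟨l, p, rfl⟩, rfl⟩
    · rintro (⟨p, rfl⟩ | ⟨ψ, -, _, ⟨l, p, rfl⟩, rfl⟩)
      · exact ⟨[], p, rfl⟩
      · exact ⟨ψ :: l, p, rfl⟩
  conv_lhs => rw [h]
  rw [genFun_union (disjoint_range_var_image2_imp _ _), genFun_range_var, genFun_image2_imp]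

theorem genFun_chains_eq_add [Finite X] :
    genFun (chains X) = genFun (freeChains X) + genFun (simpleFirst X) := by
  rw [← genFun_union]
  · congr 1
    ext φ
    constructor
    · rintro ⟨ψs, p, rfl⟩
      by_cases h : var p ∈ ψs
      · exact Or.inr ⟨ψs, p, h, rfl⟩
      · exact Or.inl ⟨ψs, p, h, rfl⟩
    · rintro (⟨ψs, p, -, rfl⟩ | ⟨ψs, p, -, rfl⟩) <;> exact ⟨ψs, p, rfl⟩
  · rw [Set.disjoint_left]
    rintro _ ⟨ψs, p, h, rfl⟩ ⟨ψs', p', h', he⟩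
    obtain ⟨rfl, rfl⟩ := chain_injective he
    exact h h'

/-- Each side counts the bare variables together with an arbitrary premise put in front of a free
chain; the left side sorts the results by whether that premise is the target. -/
theorem genFun_freeChains_add [Finite X] :
    genFun (freeChains X) + genFun (simpleFirstStrict X) =
      (Nat.card X : PowerSeries ℝ) * PowerSeries.X +
      PowerSeries.X * (genFun (Set.univ : Set (Wff X)) * genFun (freeChains X)) := by
  have h : freeChains X ∪ simpleFirstStrict X =
      Set.range var ∪ Set.image2 imp Set.univ (freeChains X) := by
    ext φ
    constructor
    · rintro (⟨ψs, p, hp, rfl⟩ | ⟨ψs, p, hp, rfl⟩)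
      · cases ψs with
        | nil => exact Or.inl ⟨p, rfl⟩
        | cons ψ l =>
          exact Or.inr ⟨ψ, trivial, chain l p, ⟨l, p, fun h => hp (List.mem_cons_of_mem _ h), rfl⟩,
            rfl⟩
      · exact Or.inr ⟨var p, trivial, chain ψs p, ⟨ψs, p, hp, rfl⟩, rfl⟩
    · rintro (⟨p, rfl⟩ | ⟨ψ, -, _, ⟨l, p, hp, rfl⟩, rfl⟩)
      · exact Or.inl ⟨[], p, by simp, rfl⟩
      · by_cases hψ : ψ = var p
        · exact Or.inr ⟨l, p, hp, by rw [hψ]; rfl⟩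
        · refine Or.inl ⟨ψ :: l, p, ?_, rfl⟩
          rw [List.mem_cons, not_or]
          exact ⟨fun h => hψ h.symm, hp⟩
  have hd : Disjoint (freeChains X) (simpleFirstStrict X) := by
    rw [Set.disjoint_left]
    rintro _ ⟨ψs, p, h, rfl⟩ ⟨ψs', p', h', he⟩
    obtain ⟨rfl, rfl⟩ := chain_injective he
    exact h List.mem_cons_self
  rw [← genFun_union hd, h, genFun_union (disjoint_range_var_image2_imp _ _), genFun_range_var,
    genFun_image2_imp]

/-- The variable `p` of a formula `ψ₁, …, ψₖ ↦ p`, and the formula itself if it is not of this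
form. -/
def target : Wff X → Wff X
  | var x => var x
  | neg φ => neg φ
  | imp _ ψ => target ψ

theorem target_chain (ψs : List (Wff X)) (p : X) : target (chain ψs p) = var p := by
  induction ψs with
  | nil => rfl
  | cons a l ih => exact ih

/-- Prefixing its own target to a free chain is a bijection onto the strict tautologies, and it adds
one variable and one arrow. -/
theorem genFun_simpleFirstStrict_eq [Finite X] :
    genFun (simpleFirstStrict X) = PowerSeries.X ^ 2 * genFun (freeChains X) := by
  rw [← genFun_image (freeChains X) (fun φ => imp (target φ) φ) 2]
  · congr 1
    ext φ
    constructor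
    · rintro ⟨ψs, p, hp, rfl⟩
      exact ⟨chain ψs p, ⟨ψs, p, hp, rfl⟩, by simp only [target_chain]; rfl⟩
    · rintro ⟨_, ⟨ψs, p, hp, rfl⟩, rfl⟩
      exact ⟨ψs, p, hp, by simp only [target_chain]; rfl⟩
  · intro a _ b _ h
    simp only [imp.injEq] at h
    exact h.2
  · rintro _ ⟨ψs, p, hp, rfl⟩
    simp only [target_chain, length]
    omega

theorem genFun_simpleFirstStrict [Finite X] :
    genFun (simpleFirstStrict X) = (Nat.card X : PowerSeries ℝ) * PowerSeries.X ^ 3 *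
      (1 + PowerSeries.X ^ 2 - PowerSeries.X * genFun (Set.univ : Set (Wff X)))⁻¹ := by
  rw [PowerSeries.eq_mul_inv_iff_mul_eq (by simp)]
  have h1 := genFun_freeChains_add (X := X)
  have h2 := genFun_simpleFirstStrict_eq (X := X)
  rw [h2] at h1 ⊢
  linear_combination PowerSeries.X ^ 2 * h1

/-- This is C - F. The difference of two inverses, rather than the product form, is what the density
computation uses: each inverse has its own limit. -/
theorem genFun_simpleFirst_eq_sub [Finite X] :
    genFun (simpleFirst X) = (Nat.card X : PowerSeries ℝ) * (PowerSeries.X *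
      ((1 - PowerSeries.X * genFun (Set.univ : Set (Wff X)))⁻¹ -
      (1 + PowerSeries.X ^ 2 - PowerSeries.X * genFun (Set.univ : Set (Wff X)))⁻¹)) := by
  have h1 : genFun (freeChains X) = (Nat.card X : PowerSeries ℝ) * PowerSeries.X *
      (1 + PowerSeries.X ^ 2 - PowerSeries.X * genFun (Set.univ : Set (Wff X)))⁻¹ := by
    rw [PowerSeries.eq_mul_inv_iff_mul_eq (by simp)]
    have h1 := genFun_freeChains_add (X := X)
    rw [genFun_simpleFirstStrict_eq] at h1
    linear_combination h1
  have h2 : genFun (chains X) = (Nat.card X : PowerSeries ℝ) * PowerSeries.X *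
      (1 - PowerSeries.X * genFun (Set.univ : Set (Wff X)))⁻¹ := by
    rw [PowerSeries.eq_mul_inv_iff_mul_eq (by simp)]
    linear_combination genFun_chains (X := X)
  have h3 := genFun_chains_eq_add (X := X)
  rw [h1, h2] at h3
  linear_combination -h3

theorem genFun_simpleFirst [Finite X] :
    genFun (simpleFirst X) = (Nat.card X : PowerSeries ℝ) * PowerSeries.X ^ 3 *
      ((1 + PowerSeries.X ^ 2 - PowerSeries.X * genFun (Set.univ : Set (Wff X))) *
        (1 - PowerSeries.X * genFun (Set.univ : Set (Wff X))))⁻¹ := by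
  rw [PowerSeries.eq_mul_inv_iff_mul_eq (by simp), genFun_simpleFirst_eq_sub]
  set W := genFun (Set.univ : Set (Wff X))
  have h1 := PowerSeries.inv_mul_cancel (1 - PowerSeries.X * W) (by simp)
  have h2 := PowerSeries.inv_mul_cancel (1 + PowerSeries.X ^ 2 - PowerSeries.X * W) (by simp)
  linear_combination (Nat.card X : PowerSeries ℝ) * PowerSeries.X *
    (1 + PowerSeries.X ^ 2 - PowerSeries.X * W) * h1 -
    (Nat.card X : PowerSeries ℝ) * PowerSeries.X * (1 - PowerSeries.X * W) * h2

end Wff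

/-! ### Convolutions with subexponential sequences -/

theorem tendsto_div_add_of_tendsto_succ_div {c : ℕ → ℝ} (hc : ∀ n, 0 < c n)
    (hr : Tendsto (fun n => c (n + 1) / c n) atTop (nhds 1)) (k : ℕ) :
    Tendsto (fun n => c n / c (n + k)) atTop (nhds 1) := by
  induction k with
  | zero =>
    refine tendsto_const_nhds.congr fun n => ?_
    rw [add_zero, div_self (hc n).ne']
  | succ k ih =>
    have h := ih.div (hr.comp (tendsto_add_atTop_nat k)) one_ne_zero
    rw [div_one] at h
    refine h.congr fun n => ?_
    have h1 := (hc (n + k)).ne'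
    have h2 := (hc (n + (k + 1))).ne'
    have h3 := (hc (n + k + 1)).ne'
    simp only [Function.comp, Pi.div_apply, ← add_assoc] at *
    field_simp

/-- Cutting at the midpoint, with the tie 2k = n in the first half, leaves two series over fixed
index sets, to which dominated convergence applies. -/
theorem sum_antidiagonal_eq_tsum_add_tsum (g : ℕ → ℕ → ℝ) (n : ℕ) :
    ∑ p ∈ Finset.HasAntidiagonal.antidiagonal n, g p.1 p.2 =
      (∑' k, if 2 * k ≤ n then g k (n - k) else 0) +
        ∑' j, if 2 * j < n then g (n - j) j else 0 := by
  rw [tsum_eq_sum (s := Finset.range (n + 1)), tsum_eq_sum (s := Finset.range (n + 1)),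
    Finset.Nat.sum_antidiagonal_eq_sum_range_succ g,
    ← Finset.sum_range_reflect (fun j => if 2 * j < n then g (n - j) j else 0),
    ← Finset.sum_add_distrib]
  · refine Finset.sum_congr rfl fun k hk => ?_
    have hk : k ≤ n := by simpa [Nat.lt_succ_iff] using hk
    have h1 : n + 1 - 1 - k = n - k := by omega
    have h2 : n - (n - k) = k := by omega
    rw [h1, h2]
    by_cases h : 2 * k ≤ n
    · rw [if_pos h, if_neg (by omega), add_zero]
    · rw [if_neg h, if_pos (by omega), zero_add]
  · intro j hj
    rw [Finset.mem_range] at hj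
    rw [if_neg (by omega)]
  · intro j hj
    rw [Finset.mem_range] at hj
    rw [if_neg (by omega)]

/-- A weighted convolution theorem for subexponential sequences `c`. -/
theorem tendsto_weighted_convolution {a b c : ℕ → ℝ} {A B K β : ℝ} (hc : ∀ n, 0 < c n)
    (hs : Summable c) (hr : Tendsto (fun n => c (n + 1) / c n) atTop (nhds 1))
    (hK : ∀ k n, k ≤ n → n ≤ 2 * k → c k ≤ K * c n)
    (ha : ∀ n, |a n| ≤ A * c n) (hb : ∀ n, |b n| ≤ B * c n)
    (hβ : Tendsto (fun n => b n / c n) atTop (nhds β)) :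
    Tendsto (fun n : ℕ => (∑ p ∈ Finset.HasAntidiagonal.antidiagonal n,
      a p.1 * (p.2 * b p.2)) / (n * c n)) atTop (nhds (β * ∑' k, a k)) := by
  have hA : 0 ≤ A := by
    have := (abs_nonneg _).trans (ha 0)
    exact nonneg_of_mul_nonneg_left this (hc 0)
  have hB : 0 ≤ B := by
    have := (abs_nonneg _).trans (hb 0)
    exact nonneg_of_mul_nonneg_left this (hc 0)
  have hK0 : 0 ≤ K := by
    have := (hc 0).le.trans (hK 0 0 le_rfl (by omega))
    exact nonneg_of_mul_nonneg_left this (hc 0)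
  have hfrac : ∀ (x n : ℕ), x ≤ n → (x : ℝ) / n ≤ 1 := fun x n h =>
    div_le_one_of_le₀ (by exact_mod_cast h) (Nat.cast_nonneg _)
  have hfrac0 : ∀ (x n : ℕ), 0 ≤ (x : ℝ) / n := fun x n => by positivity
  -- Small first index: for fixed k the factor (n-k)b(n-k)/(n c(n)) tends to β, since c(n-k)/c(n) →
  -- 1.
  have h1 : Tendsto (fun n : ℕ => ∑' k, if 2 * k ≤ n then
      a k * (((n - k : ℕ) : ℝ) * b (n - k)) / (n * c n) else 0) atTop
      (nhds (∑' k, a k * β)) := by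
    refine tendsto_tsum_of_dominated_convergence (bound := fun k => A * B * K * c k)
      (hs.mul_left _) (fun k => ?_) (Eventually.of_forall fun n k => ?_)
    · rw [← tendsto_add_atTop_iff_nat k]
      have e1 : Tendsto (fun n : ℕ => ((n : ℝ)) / ((n : ℝ) + (k : ℝ))) atTop (nhds 1) :=
        tendsto_natCast_div_add_atTop (k : ℝ)
      have e2 := ((hβ.mul (tendsto_div_add_of_tendsto_succ_div hc hr k)).mul e1).const_mul (a k)
      rw [mul_one, mul_one] at e2
      refine e2.congr' ?_
      filter_upwards [eventually_ge_atTop (k + 1)] with n hn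
      rw [if_pos (by omega), Nat.add_sub_cancel]
      have := (hc n).ne'
      have := (hc (n + k)).ne'
      push_cast
      field_simp
    · split_ifs with h
      · rw [Real.norm_eq_abs, abs_div, abs_mul, abs_mul, Nat.abs_cast, abs_mul, Nat.abs_cast,
          abs_of_pos (hc n)]
        have e1 : |a k| * (((n - k : ℕ) : ℝ) * |b (n - k)|) / (n * c n) =
            |a k| * ((((n - k : ℕ) : ℝ) / n) * (|b (n - k)| / c n)) := by
          rw [mul_div_assoc, mul_div_mul_comm]
        have e2 : |b (n - k)| / c n ≤ B * K := by
          rw [div_le_iff₀ (hc n), mul_assoc]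
          exact (hb _).trans (mul_le_mul_of_nonneg_left (hK _ _ (by omega) (by omega)) hB)
        rw [e1]
        calc _ ≤ A * c k * (1 * (B * K)) := by
              have := hfrac (n - k) n (by omega)
              have := hfrac0 (n - k) n
              have := (hc n).le
              have := ha k
              have := mul_nonneg hA (hc k).le
              gcongr
          _ = _ := by ring
      · rw [norm_zero]
        have := (hc k).le
        positivity
  -- Small second index: the weight j/n kills every fixed term, so no limit of a(n)/c(n) is needed.
  have h2 : Tendsto (fun n : ℕ => ∑' j, if 2 * j < n then
      a (n - j) * ((j : ℝ) * b j) / (n * c n) else 0) atTop (nhds (∑' _ : ℕ, (0 : ℝ))) := by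
    have hbd : ∀ n j : ℕ, ‖if 2 * j < n then
        a (n - j) * ((j : ℝ) * b j) / (n * c n) else 0‖ ≤ A * B * K * c j * ((j : ℝ) / n) := by
      intro n j
      split_ifs with h
      · rw [Real.norm_eq_abs, abs_div, abs_mul, abs_mul, Nat.abs_cast, abs_mul, Nat.abs_cast,
          abs_of_pos (hc n)]
        have e1 : |a (n - j)| * ((j : ℝ) * |b j|) / (n * c n) =
            (|a (n - j)| / c n) * (|b j| * ((j : ℝ) / n)) := by
          ring
        have e2 : |a (n - j)| / c n ≤ A * K := by
          rw [div_le_iff₀ (hc n), mul_assoc]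
          exact (ha _).trans (mul_le_mul_of_nonneg_left (hK _ _ (by omega) (by omega)) hA)
        rw [e1]
        calc _ ≤ A * K * ((B * c j) * ((j : ℝ) / n)) := by
              have := hfrac0 j n
              have := (abs_nonneg (a (n - j))).trans (ha _)
              have : 0 ≤ |a (n - j)| / c n := div_nonneg (abs_nonneg _) (hc n).le
              have := this.trans e2
              gcongr
              exact hb j
          _ = _ := by ring
      · rw [norm_zero]
        have := (hc j).le
        positivity
    refine tendsto_tsum_of_dominated_convergence (bound := fun k => A * B * K * c k)
      (hs.mul_left _) (fun j => ?_) (Eventually.of_forall fun n j => ?_)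
    · refine squeeze_zero_norm (fun n => hbd n j) ?_
      simpa using (tendsto_const_div_atTop_nhds_zero_nat (j : ℝ)).const_mul (A * B * K * c j)
    · have h0 : 0 ≤ A * B * K * c j := by
        have := (hc j).le
        positivity
      by_cases h : 2 * j < n
      · exact (hbd n j).trans (mul_le_of_le_one_right h0 (hfrac j n (by omega)))
      · rwa [if_neg h, norm_zero]
  have h3 := h1.add h2
  rw [tsum_zero, add_zero, tsum_mul_right, mul_comm] at h3
  refine h3.congr fun n => ?_
  rw [← sum_antidiagonal_eq_tsum_add_tsum (fun i j => a i * ((j : ℝ) * b j) / (n * c n)),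
    Finset.sum_div]

/-! ### Evaluation of power series at a real point -/

/-- The power series `A` converges absolutely at `r`, with sum `a`. -/
def PowerSeries.SumsTo (r : ℝ) (A : PowerSeries ℝ) (a : ℝ) : Prop :=
  Summable (fun n => ‖PowerSeries.coeff n A * r ^ n‖) ∧
    ∑' n, PowerSeries.coeff n A * r ^ n = a

namespace PowerSeries.SumsTo

variable {r a b : ℝ} {A B : PowerSeries ℝ}

theorem add (hA : SumsTo r A a) (hB : SumsTo r B b) : SumsTo r (A + B) (a + b) := by
  simp only [SumsTo, map_add, add_mul]
  refine ⟨(hA.1.add hB.1).of_nonneg_of_le (fun _ => norm_nonneg _) fun _ => norm_add_le _ _, ?_⟩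
  rw [hA.1.of_norm.tsum_add hB.1.of_norm, hA.2, hB.2]

theorem mul (hA : SumsTo r A a) (hB : SumsTo r B b) : SumsTo r (A * B) (a * b) := by
  have h : ∀ n, coeff n (A * B) * r ^ n = ∑ p ∈ Finset.HasAntidiagonal.antidiagonal n,
      (coeff p.1 A * r ^ p.1) * (coeff p.2 B * r ^ p.2) := by
    intro n
    rw [coeff_mul, Finset.sum_mul]
    refine Finset.sum_congr rfl fun p hp => ?_
    rw [← Finset.HasAntidiagonal.mem_antidiagonal.1 hp, pow_add]
    ring
  have h1 := summable_norm_sum_mul_antidiagonal_of_summable_norm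
    (f := fun n => coeff n A * r ^ n) (g := fun n => coeff n B * r ^ n) hA.1 hB.1
  have h2 := tsum_mul_tsum_eq_tsum_sum_antidiagonal_of_summable_norm
    (f := fun n => coeff n A * r ^ n) (g := fun n => coeff n B * r ^ n) hA.1 hB.1
  rw [hA.2, hB.2] at h2
  exact ⟨by simpa only [h] using h1, by simpa only [h] using h2.symm⟩

theorem of_monomial (r : ℝ) (k : ℕ) (x : ℝ) : SumsTo r (monomial k x) (x * r ^ k) := by
  have h : ∀ n, n ≠ k → coeff n (monomial k x) * r ^ n = 0 := fun n hn => by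
    rw [coeff_monomial, if_neg hn, zero_mul]
  refine ⟨summable_of_ne_finset_zero (s := {k}) fun n hn => ?_, ?_⟩
  · rw [h n (by simpa using hn), norm_zero]
  · rw [tsum_eq_single k h, coeff_monomial_same]

theorem of_C (r x : ℝ) : SumsTo r (C x) x := by
  have h := of_monomial r 0 x
  rwa [monomial_zero_eq_C_apply, pow_zero, mul_one] at h

theorem of_X (r : ℝ) : SumsTo r X r := by
  have h := of_monomial r 1 1
  rwa [← X_eq, pow_one, one_mul] at h

theorem of_one (r : ℝ) : SumsTo r 1 1 := by
  have h := of_C r 1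
  rwa [map_one] at h

theorem sub (hA : SumsTo r A a) (hB : SumsTo r B b) : SumsTo r (A - B) (a - b) := by
  have h : A - B = A + C (-1) * B := by simp [sub_eq_add_neg]
  rw [h, show a - b = a + -1 * b by ring]
  exact hA.add ((of_C r (-1)).mul hB)

theorem unique (hA : SumsTo r A a) (hA' : SumsTo r A b) : a = b := hA.2.symm.trans hA'.2

end PowerSeries.SumsTo

theorem PowerSeries.coeff_X_mul_derivative (f : PowerSeries ℝ) (n : ℕ) :
    coeff n (X * derivative ℝ f) = n * coeff n f := by
  cases n with
  | zero => simp
  | succ n =>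
    rw [coeff_succ_X_mul, coeff_derivative]
    push_cast
    ring

/-! ### Two estimates for real sequences -/

/-- The triangle of index pairs lies in the square. It serves to bound partial sums of W² before
convergence is known. -/
theorem sum_range_sum_antidiagonal_le {a : ℕ → ℝ} (ha : ∀ n, 0 ≤ a n) (N : ℕ) :
    ∑ n ∈ Finset.range N, ∑ p ∈ Finset.HasAntidiagonal.antidiagonal n, a p.1 * a p.2 ≤
      (∑ n ∈ Finset.range N, a n) ^ 2 := by
  rw [sq, Finset.sum_mul_sum, ← Finset.sum_product']
  have h : ∀ n ∈ Finset.range N, Finset.HasAntidiagonal.antidiagonal n =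
      (Finset.range N ×ˢ Finset.range N).filter fun p => p.1 + p.2 = n := by
    intro n hn
    ext ⟨i, j⟩
    simp only [Finset.HasAntidiagonal.mem_antidiagonal, Finset.mem_filter, Finset.mem_product,
      Finset.mem_range] at hn ⊢
    omega
  rw [Finset.sum_congr rfl fun n hn => by rw [h n hn]]
  exact Finset.sum_fiberwise_le_sum_of_sum_fiber_nonneg fun y _ =>
    Finset.sum_nonneg fun p _ => mul_nonneg (ha _) (ha _)

/-- In terms of n·t(n) the hypothesis is a contraction with factor eventually below some q < 1, plus
a bounded term. So n·t(n) stays bounded and t(n) = O(1/n). -/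
theorem tendsto_zero_of_le_contraction {t : ℕ → ℝ} {θ : ℝ} (h0 : ∀ n, 0 ≤ t n) (hθ0 : 0 ≤ θ)
    (hθ : θ < 1) (h : ∀ n : ℕ, n * t (n + 1) ≤ θ * (n + 3) * t n + 3) :
    Tendsto t atTop (nhds 0) := by
  obtain ⟨q, hq, hq1⟩ := exists_between hθ
  have hq0 : 0 < q := hθ0.trans_lt hq
  have hlim : Tendsto (fun n : ℕ => θ * (((n : ℝ) + 3) / n * (((n : ℝ) + 1) / n))) atTop
      (nhds (θ * (1 * 1))) := by
    have h1 : ∀ x : ℝ, Tendsto (fun n : ℕ => ((n : ℝ) + x) / n) atTop (nhds 1) := by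
      intro x
      have := (tendsto_const_div_atTop_nhds_zero_nat x).const_add 1
      rw [add_zero] at this
      refine this.congr' ?_
      filter_upwards [eventually_gt_atTop 0] with n hn
      field_simp
    exact ((h1 3).mul (h1 1)).const_mul θ
  rw [mul_one, mul_one] at hlim
  obtain ⟨N, hN⟩ := eventually_atTop.1 (hlim.eventually_lt_const hq)
  set M := N + 1
  -- The value 6/(1-q) is the fixed point of x ↦ qx + 6, where 6 bounds 3(n+1)/n; any larger bound
  -- is also preserved.
  set A := max (M * t M) (6 / (1 - q))
  have hA : 6 / (1 - q) ≤ A := le_max_right _ _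
  have hA0 : 0 ≤ A := (div_nonneg (by norm_num) (by linarith)).trans hA
  rw [div_le_iff₀ (by linarith)] at hA
  have key : ∀ n, M ≤ n → n * t n ≤ A := by
    intro n hn
    induction n, hn using Nat.le_induction with
    | base => exact le_max_left _ _
    | succ n hn ih =>
      have hn1 : (1 : ℝ) ≤ n := by exact_mod_cast (by omega : 1 ≤ n)
      have h1 := hN n (by omega)
      have h2 : ((n : ℝ) + 1) / n ≤ 2 := by rw [div_le_iff₀ (by linarith)]; linarith
      have h3 : t (n + 1) ≤ (θ * (n + 3) * t n + 3) / n := by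
        rw [le_div_iff₀ (by linarith), mul_comm]; exact h n
      calc ((n + 1 : ℕ) : ℝ) * t (n + 1) ≤ (n + 1) * ((θ * (n + 3) * t n + 3) / n) := by
            push_cast; gcongr
        _ = θ * (((n : ℝ) + 3) / n * (((n : ℝ) + 1) / n)) * (n * t n)
            + 3 * (((n : ℝ) + 1) / n) := by field_simp
        _ ≤ q * A + 3 * 2 := by
            have := mul_nonneg (by linarith : (0 : ℝ) ≤ n) (h0 n)
            gcongr
        _ ≤ A := by linarith
  refine squeeze_zero' (Eventually.of_forall h0) ?_ (tendsto_const_div_atTop_nhds_zero_nat A)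
  filter_upwards [eventually_ge_atTop M] with n hn
  have hn1 : (0 : ℝ) < n := by exact_mod_cast (by omega : 0 < n)
  rw [le_div_iff₀ hn1, mul_comm]
  exact key n hn

/-! ### The quadratic equation and the recurrence for its coefficients -/

namespace PowerSeries

/-- The power series `W` has nonnegative coefficients and solves `W = s² X + X W + X W²`, where
`s ≥ 1`. -/
structure IsWffSeries (s : ℝ) (W : PowerSeries ℝ) : Prop where
  one_le : 1 ≤ s
  eqn : W = C (s ^ 2) * X + X * W + X * W ^ 2
  nonneg : ∀ n, 0 ≤ coeff n W

namespace IsWffSeries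

variable {s : ℝ} {W : PowerSeries ℝ} (h : IsWffSeries s W)
include h

theorem coeff_zero : coeff 0 W = 0 := by
  rw [h.eqn]; simp

theorem coeff_succ (n : ℕ) : coeff (n + 1) W =
    (if n = 0 then s ^ 2 else 0) + coeff n W + coeff n (W ^ 2) := by
  conv_lhs => rw [h.eqn]
  rw [map_add, map_add, coeff_succ_mul_X, coeff_succ_X_mul, coeff_succ_X_mul, coeff_C]

theorem coeff_sq_nonneg (n : ℕ) : 0 ≤ coeff n (W ^ 2) := by
  rw [sq, coeff_mul]
  exact Finset.sum_nonneg fun p _ => mul_nonneg (h.nonneg _) (h.nonneg _)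

theorem coeff_mono (n : ℕ) : coeff n W ≤ coeff (n + 1) W := by
  rw [h.coeff_succ]
  have := h.coeff_sq_nonneg n
  split_ifs <;> nlinarith [sq_nonneg s]

theorem coeff_succ_pos (n : ℕ) : 0 < coeff (n + 1) W := by
  induction n with
  | zero =>
    rw [h.coeff_succ, h.coeff_zero, if_pos rfl]
    have := h.coeff_sq_nonneg 0
    have := h.one_le
    positivity
  | succ n ih => exact ih.trans_le (h.coeff_mono _)

/-- The recurrence that follows from the differential equation of `√((1 - X)² - 4 s² X²)`. -/
theorem recurrence (n : ℕ) : (n + 3) * coeff (n + 2) W =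
    (2 * n + 3) * coeff (n + 1) W + (4 * s ^ 2 - 1) * n * coeff n W := by
  set κ : ℝ := 4 * s ^ 2 - 1 with hκ
  set Y : PowerSeries ℝ := X * W with hY
  have hX : derivative ℝ (X : PowerSeries ℝ) = 1 := derivative_X
  -- Completing the square in the quadratic equation for W.
  have hsq : (1 - X - 2 * Y) ^ 2 = 1 - 2 * X - C κ * X ^ 2 := by
    have : (C κ : PowerSeries ℝ) = 4 * C (s ^ 2) - 1 := by
      rw [hκ, map_sub, map_mul, map_one, map_ofNat]
    rw [this, hY]
    linear_combination (-4) * X * h.eqn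
  have hT : derivative ℝ (1 - X - 2 * Y) = -1 - 2 * derivative ℝ Y := by
    have : (2 : PowerSeries ℝ) = C 2 := (map_ofNat C 2).symm
    rw [map_sub, map_sub, derivative_one, hX, this, Derivation.leibniz, derivative_C]
    simp
  have hd : (1 - X - 2 * Y) * (-1 - 2 * derivative ℝ Y) = -1 - C κ * X := by
    have h1 := congrArg (derivative ℝ) hsq
    have h2 : derivative ℝ (1 - 2 * X - C κ * X ^ 2) = 2 * (-1 - C κ * X) := by
      have : (2 : PowerSeries ℝ) = C 2 := (map_ofNat C 2).symm
      rw [map_sub, map_sub, derivative_one, this, Derivation.leibniz, Derivation.leibniz,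
        derivative_C, derivative_C, derivative_pow, hX]
      simp
      linear_combination (-(C κ * X)) * this
    rw [h2, derivative_pow, hT] at h1
    have h3 : (2 : PowerSeries ℝ) ≠ 0 := fun h0 => by
      have := congrArg constantCoeff h0
      rw [map_ofNat, map_zero] at this
      norm_num at this
    refine mul_left_cancel₀ h3 ?_
    rw [← h1]
    push_cast
    ring
  -- With T = 1 - X - 2Y and D = T², multiplying TT' = D'/2 by T gives the linear equation D·T' =
  -- (D'/2)·T. It is written out in Y and multiplied by X; the right side contributes nothing to the
  -- coefficients read off next.
  have hode : C 2 * ((X * derivative ℝ Y) - C 2 * (X * (X * derivative ℝ Y)) -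
      C κ * (X * (X * (X * derivative ℝ Y))) + X * Y + C κ * (X * (X * Y))) =
      X * (X * (1 + C κ)) := by
    have : (C 2 : PowerSeries ℝ) = 2 := map_ofNat C 2
    rw [this]
    linear_combination X * (-1 - 2 * derivative ℝ Y) * hsq - X * (1 - X - 2 * Y) * hd
  have hc := congrArg (coeff (n + 3)) hode
  have hX1 : coeff (n + 1) (1 + C κ : PowerSeries ℝ) = 0 := by
    rw [map_add, coeff_one, coeff_C]; simp
  simp only [coeff_C_mul, map_add, map_sub, coeff_derivative, coeff_succ_X_mul, hY] at hc
  rw [← map_add, hX1] at hc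
  push_cast at hc
  linarith

end IsWffSeries
end PowerSeries

/-! ### Growth of the coefficients of W -/

namespace PowerSeries

/-- The dominant part `w (n + 1) + (2 s - 1) w n` of the coefficients `w` of `W`. -/
noncomputable def dominant (s : ℝ) (W : PowerSeries ℝ) (n : ℕ) : ℝ :=
  coeff (n + 1) W + (2 * s - 1) * coeff n W

namespace IsWffSeries

variable {s : ℝ} {W : PowerSeries ℝ} (h : IsWffSeries s W)
include h

theorem dominant_pos (n : ℕ) : 0 < dominant s W n := by
  have h1 := h.coeff_succ_pos n
  have h2 := h.nonneg n
  have h3 := h.one_le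
  have := mul_nonneg (by linarith : 0 ≤ 2 * s - 1) h2
  unfold dominant
  linarith

theorem add_coeff_le_dominant (n : ℕ) : coeff n W + coeff (n + 1) W ≤ dominant s W n := by
  have h2 := h.nonneg n
  have h3 := h.one_le
  unfold dominant
  nlinarith

theorem coeff_le_dominant (n : ℕ) : coeff n W ≤ dominant s W n := by
  have := h.nonneg (n + 1)
  have := h.add_coeff_le_dominant n
  linarith

/-- By the recurrence the two sides differ by exactly 6s·w_{n+1} ≥ 0. -/
theorem le_dominant_succ (n : ℕ) :
    n * (1 + 2 * s) * dominant s W n ≤ (n + 3) * dominant s W (n + 1) := by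
  have h1 := h.recurrence n
  have h2 := h.nonneg n
  have h3 := h.one_le
  have h4 := h.nonneg (n + 1)
  have h5 : 0 ≤ (s - 1) * coeff (n + 1) W := mul_nonneg (by linarith) h4
  unfold dominant
  linarith

theorem mul_abs_succ_le (n : ℕ) :
    (n + 3) * |coeff (n + 2) W - (1 + 2 * s) * coeff (n + 1) W| ≤
      (n + 3) * (2 * s - 1) * |coeff (n + 1) W - (1 + 2 * s) * coeff n W| +
        3 * (1 + 2 * s) * dominant s W n := by
  have h1 := h.recurrence n
  have h2 := h.nonneg n
  have h3 := h.one_le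
  have h4 := h.nonneg (n + 1)
  -- The recurrence rewritten for w_{n+1} - (1+2s)w_n: up to the last term, this quantity is
  -- multiplied by the smaller root -(2s-1).
  have h5 : (n + 3) * (coeff (n + 2) W - (1 + 2 * s) * coeff (n + 1) W) =
      -((n + 3) * (2 * s - 1) * (coeff (n + 1) W - (1 + 2 * s) * coeff n W)) -
        3 * (coeff (n + 1) W + (4 * s ^ 2 - 1) * coeff n W) := by
    rw [mul_sub, h1]; ring
  have h6 : 0 ≤ (4 * s ^ 2 - 1) * coeff n W := mul_nonneg (by nlinarith) h2
  have h7 : 0 ≤ (s - 1) * coeff (n + 1) W := mul_nonneg (by linarith) h4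
  have h8 : (0 : ℝ) ≤ (n + 3) * (2 * s - 1) := mul_nonneg (by positivity) (by linarith)
  have h9 : (0 : ℝ) ≤ n + 3 := by positivity
  calc _ = |(n + 3) * (coeff (n + 2) W - (1 + 2 * s) * coeff (n + 1) W)| := by
        rw [abs_mul, abs_of_nonneg h9]
    _ ≤ |(n + 3) * (2 * s - 1) * (coeff (n + 1) W - (1 + 2 * s) * coeff n W)| +
        |3 * (coeff (n + 1) W + (4 * s ^ 2 - 1) * coeff n W)| := by
        rw [h5]
        refine (abs_sub _ _).trans ?_
        rw [abs_neg]
    _ ≤ _ := by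
        rw [abs_mul ((n + 3) * (2 * s - 1) : ℝ), abs_of_nonneg h8,
          abs_of_nonneg (by linarith : 0 ≤ 3 * (coeff (n + 1) W + (4 * s ^ 2 - 1) * coeff n W))]
        unfold dominant
        linarith

/-- The error grows at most like (2s-1)ⁿ up to lower-order terms, while `dominant` gains a factor of
at least (1+2s)n/(n+3) per step; their quotient contracts by (2s-1)/(1+2s) < 1. -/
theorem tendsto_error :
    Tendsto (fun n => |coeff (n + 1) W - (1 + 2 * s) * coeff n W| / dominant s W n) atTop
      (nhds 0) := by
  have hs := h.one_le
  refine tendsto_zero_of_le_contraction (θ := (2 * s - 1) / (1 + 2 * s))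
    (fun n => div_nonneg (abs_nonneg _) (h.dominant_pos n).le)
    (div_nonneg (by linarith) (by linarith)) ?_ fun n => ?_
  · rw [div_lt_one (by linarith)]; linarith
  · have h1 := h.le_dominant_succ n
    have h2 := h.mul_abs_succ_le n
    have h3 := h.dominant_pos n
    have h4 := h.dominant_pos (n + 1)
    set a := |coeff (n + 1) W - (1 + 2 * s) * coeff n W|
    set b := |coeff (n + 2) W - (1 + 2 * s) * coeff (n + 1) W|
    have hb : 0 ≤ b := abs_nonneg _
    set x := dominant s W n
    set y := dominant s W (n + 1)
    have hn : (0 : ℝ) < n + 3 := by positivity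
    have hl : 0 < 1 + 2 * s := by linarith
    have e : (2 * s - 1) / (1 + 2 * s) * (n + 3) * (a / x) + 3 =
        ((n + 3) * (2 * s - 1) * a + 3 * (1 + 2 * s) * x) / ((1 + 2 * s) * x) := by
      field_simp
    rw [e, ← mul_div_assoc, div_le_div_iff₀ h4 (by positivity)]
    calc n * b * ((1 + 2 * s) * x) = b * (n * (1 + 2 * s) * x) := by ring
      _ ≤ b * ((n + 3) * y) := by gcongr
      _ = (n + 3) * b * y := by ring
      _ ≤ _ := by gcongr

/-- Subtracting w_{n+1} - (1+2s)w_n from d_n leaves exactly 4s·w_n. -/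
theorem tendsto_coeff_div_dominant :
    Tendsto (fun n => coeff n W / dominant s W n) atTop (nhds (1 / (4 * s))) := by
  have hs := h.one_le
  have h1 : Tendsto (fun n => (coeff (n + 1) W - (1 + 2 * s) * coeff n W) / dominant s W n) atTop
      (nhds 0) := by
    rw [tendsto_zero_iff_abs_tendsto_zero]
    refine h.tendsto_error.congr fun n => ?_
    simp only [Function.comp, abs_div, abs_of_pos (h.dominant_pos n)]
  have h2 := (h1.const_sub 1).div_const (4 * s)
  rw [sub_zero] at h2
  refine h2.congr fun n => ?_
  have := (h.dominant_pos n).ne'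
  field_simp
  unfold dominant
  ring

theorem tendsto_coeff_succ_div_dominant :
    Tendsto (fun n => coeff (n + 1) W / dominant s W n) atTop
      (nhds ((1 + 2 * s) / (4 * s))) := by
  have hs := h.one_le
  have h2 := (h.tendsto_coeff_div_dominant.const_mul (2 * s - 1)).const_sub 1
  have e : (1 + 2 * s) / (4 * s) = 1 - (2 * s - 1) * (1 / (4 * s)) := by field_simp; ring
  rw [e]
  refine h2.congr fun n => ?_
  have := (h.dominant_pos n).ne'
  field_simp
  unfold dominant
  ring

theorem tendsto_dominant_succ_div :
    Tendsto (fun n => dominant s W (n + 1) / dominant s W n) atTop (nhds (1 + 2 * s)) := by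
  have hs := h.one_le
  have h1 := h.tendsto_coeff_succ_div_dominant.div
    (h.tendsto_coeff_div_dominant.comp (tendsto_add_atTop_nat 1)) (by positivity)
  have e : (1 + 2 * s) / (4 * s) / (1 / (4 * s)) = 1 + 2 * s := by field_simp
  rw [e] at h1
  refine h1.congr fun n => ?_
  have := (h.dominant_pos n).ne'
  have := (h.dominant_pos (n + 1)).ne'
  have := (h.coeff_succ_pos n).ne'
  simp only [Function.comp, Pi.div_apply]
  field_simp

/-! ### Normalization at r = 1/(1+2s) and the value W(r) = s -/

/-- The dominant part of the coefficients, normalized at the dominant singularity. -/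
theorem tendsto_normalized_succ_div {r : ℝ} (hr : r = (1 + 2 * s)⁻¹) :
    Tendsto (fun n => dominant s W (n + 1) * r ^ (n + 1) / (dominant s W n * r ^ n)) atTop
      (nhds 1) := by
  have hs := h.one_le
  have h1 := h.tendsto_dominant_succ_div.mul_const r
  have e : (1 + 2 * s) * r = 1 := by rw [hr]; exact mul_inv_cancel₀ (by linarith)
  have hr0 : 0 < r := by rw [hr]; positivity
  rw [e] at h1
  refine h1.congr fun n => ?_
  have := (h.dominant_pos n).ne'
  field_simp
  ring

/-- By `le_dominant_succ`, n(n+1)(n+2)·d_n rⁿ is nondecreasing. Doubling the index raises the cubic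
factor by at most 2³, whence the constant 8. -/
theorem normalized_le {r : ℝ} (hr : r = (1 + 2 * s)⁻¹) (k n : ℕ) (hkn : k ≤ n) (hnk : n ≤ 2 * k) :
    dominant s W k * r ^ k ≤ 8 * (dominant s W n * r ^ n) := by
  have hs := h.one_le
  have hr0 : 0 < r := by rw [hr]; positivity
  have hpos : ∀ n, 0 < dominant s W n * r ^ n := fun n => by
    have := h.dominant_pos n
    positivity
  have hmono : Monotone fun n : ℕ => ((n : ℝ) + 2) * (n + 1) * n * (dominant s W n * r ^ n) := by
    refine monotone_nat_of_le_succ fun n => ?_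
    have h1 := h.le_dominant_succ n
    have e : (1 + 2 * s) * r = 1 := by rw [hr]; exact mul_inv_cancel₀ (by linarith)
    calc ((n : ℝ) + 2) * (n + 1) * n * (dominant s W n * r ^ n)
        = ((n : ℝ) + 2) * (n + 1) * r ^ (n + 1) * (n * (1 + 2 * s) * dominant s W n) := by
          linear_combination (-((n : ℝ) + 2) * (n + 1) * n * (dominant s W n * r ^ n)) * e
      _ ≤ ((n : ℝ) + 2) * (n + 1) * r ^ (n + 1) * ((n + 3) * dominant s W (n + 1)) := by gcongr
      _ = _ := by push_cast; ring
  rcases Nat.eq_zero_or_pos k with rfl | hk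
  · have : n = 0 := by omega
    subst this
    linarith [hpos 0]
  have h2 := hmono hkn
  have hk1 : (1 : ℝ) ≤ k := by exact_mod_cast hk
  have hn2 : (n : ℝ) ≤ 2 * k := by exact_mod_cast hnk
  have h3 : ((n : ℝ) + 2) * (n + 1) * n ≤ 8 * (((k : ℝ) + 2) * (k + 1) * k) := by
    calc ((n : ℝ) + 2) * (n + 1) * n ≤ (2 * (k + 2)) * (2 * (k + 1)) * (2 * k) := by
          gcongr <;> linarith
      _ = _ := by ring
  have h4 : (0 : ℝ) < ((k : ℝ) + 2) * (k + 1) * k := by positivity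
  refine le_of_mul_le_mul_left ?_ h4
  calc _ ≤ _ := h2
    _ ≤ 8 * (((k : ℝ) + 2) * (k + 1) * k) * (dominant s W n * r ^ n) := by
      exact mul_le_mul_of_nonneg_right h3 (hpos n).le
    _ = _ := by ring

/-- Induction on the partial sums: each is at most r(s² + x + x²) with x the previous one, and s is
a fixed point of this increasing map. -/
theorem sum_coeff_le {r : ℝ} (hr : r = (1 + 2 * s)⁻¹) (N : ℕ) :
    ∑ n ∈ Finset.range N, coeff n W * r ^ n ≤ s := by
  have hs := h.one_le
  have hr0 : 0 < r := by rw [hr]; positivity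
  have hw : ∀ n, 0 ≤ coeff n W * r ^ n := fun n => by
    have := h.nonneg n
    positivity
  induction N with
  | zero => simp; linarith
  | succ N ih =>
    have hS := Finset.sum_nonneg fun n (_ : n ∈ Finset.range N) => hw n
    have h1 : ∀ n, coeff (n + 1) W * r ^ (n + 1) =
        r * ((if n = 0 then s ^ 2 * r ^ n else 0) + coeff n W * r ^ n +
          ∑ p ∈ Finset.HasAntidiagonal.antidiagonal n,
            (coeff p.1 W * r ^ p.1) * (coeff p.2 W * r ^ p.2)) := by
      intro n
      have : coeff n (W ^ 2) * r ^ n = ∑ p ∈ Finset.HasAntidiagonal.antidiagonal n,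
            (coeff p.1 W * r ^ p.1) * (coeff p.2 W * r ^ p.2) := by
        rw [sq, coeff_mul, Finset.sum_mul]
        refine Finset.sum_congr rfl fun p hp => ?_
        rw [← Finset.HasAntidiagonal.mem_antidiagonal.1 hp, pow_add]
        ring
      rw [h.coeff_succ, ← this]
      split_ifs <;> ring
    have h2 : ∑ n ∈ Finset.range N, (if n = 0 then s ^ 2 * r ^ n else 0) ≤ s ^ 2 := by
      rw [Finset.sum_ite_eq' (Finset.range N) 0 (fun n => s ^ 2 * r ^ n)]
      split_ifs
      · simp
      · positivity
    have h3 := sum_range_sum_antidiagonal_le hw N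
    rw [Finset.sum_range_succ', h.coeff_zero, zero_mul, add_zero,
      Finset.sum_congr rfl fun n _ => h1 n, ← Finset.mul_sum, Finset.sum_add_distrib,
      Finset.sum_add_distrib]
    calc _ ≤ r * (s ^ 2 + s + s ^ 2) := by gcongr; exact h3.trans (by gcongr)
      _ = s * ((1 + 2 * s) * r) := by ring
      _ = s := by rw [hr, mul_inv_cancel₀ (by linarith), mul_one]

theorem sumsTo {r : ℝ} (hr : r = (1 + 2 * s)⁻¹) : SumsTo r W s := by
  have hs := h.one_le
  have hr0 : 0 < r := by rw [hr]; positivity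
  have hw : ∀ n, 0 ≤ coeff n W * r ^ n := fun n => by
    have := h.nonneg n
    positivity
  have hsum : Summable fun n => coeff n W * r ^ n :=
    summable_of_sum_range_le hw (h.sum_coeff_le hr)
  have h1 : SumsTo r W (∑' n, coeff n W * r ^ n) := ⟨hsum.norm, rfl⟩
  set w := ∑' n, coeff n W * r ^ n
  have h2 := (((SumsTo.of_C r (s ^ 2)).mul (SumsTo.of_X r)).add ((SumsTo.of_X r).mul h1)).add
    ((SumsTo.of_X r).mul (h1.mul h1))
  rw [← sq, ← h.eqn] at h2
  have h3 := h1.unique h2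
  have e : (1 + 2 * s) * r = 1 := by rw [hr]; exact mul_inv_cancel₀ (by linarith)
  -- At z = r the discriminant vanishes, so the quadratic equation has the double root s and no
  -- branch has to be chosen.
  have h4 : r * (w - s) ^ 2 = 0 := by linear_combination (-1) * h3 - w * e
  have h5 : w - s = 0 := by
    rcases mul_eq_zero.1 h4 with h5 | h5
    · exact absurd h5 hr0.ne'
    · exact pow_eq_zero_iff two_ne_zero |>.1 h5
  rwa [sub_eq_zero.1 h5] at h1

theorem summable_dominant {r : ℝ} (hr : r = (1 + 2 * s)⁻¹) :
    Summable fun n => dominant s W n * r ^ n := by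
  have hs := h.one_le
  have hr0 : 0 < r := by rw [hr]; positivity
  have h1 := (h.sumsTo hr).1.of_norm
  have h2 := (((summable_nat_add_iff 1).2 h1).mul_left r⁻¹).add (h1.mul_left (2 * s - 1))
  refine h2.congr fun n => ?_
  unfold dominant
  field_simp
  ring

end IsWffSeries
end PowerSeries

/-! ### Coefficients of 1/(1 - V) for V dominated by XW -/

theorem PowerSeries.constantCoeff_eq_zero_of_le {V W : PowerSeries ℝ} (hV0 : ∀ n, 0 ≤ coeff n V)
    (hV : ∀ n, coeff n V ≤ coeff n (X * W)) : constantCoeff V = 0 := by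
  have h1 := hV0 0
  have h2 := hV 0
  rw [coeff_zero_X_mul] at h2
  rw [← coeff_zero_eq_constantCoeff_apply]
  linarith

theorem PowerSeries.one_sub_mul_inv_of_le {V W : PowerSeries ℝ} (hV0 : ∀ n, 0 ≤ coeff n V)
    (hV : ∀ n, coeff n V ≤ coeff n (X * W)) : (1 - V) * (1 - V)⁻¹ = 1 :=
  PowerSeries.mul_inv_cancel _ (by simp [constantCoeff_eq_zero_of_le hV0 hV])

namespace PowerSeries.IsWffSeries

variable {s : ℝ} {W : PowerSeries ℝ} (h : IsWffSeries s W)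
include h

theorem coeff_X_mul_le (n : ℕ) : coeff n (X * W) ≤ coeff n W := by
  cases n with
  | zero => rw [coeff_zero_X_mul]; exact h.nonneg 0
  | succ n => rw [coeff_succ_X_mul]; exact h.coeff_mono n

variable {V : PowerSeries ℝ} (hV0 : ∀ n, 0 ≤ coeff n V) (hV : ∀ n, coeff n V ≤ coeff n (X * W))
include hV0 hV

/-- P = 1/(1-V) solves P = 1 + VP, while Q = 1 + W solves Q = 1 + s²X + XW·Q, which has larger data.
As V has no constant term, strong induction compares the two. -/
theorem coeff_inv_mem (n : ℕ) : 0 ≤ coeff n (1 - V)⁻¹ ∧ coeff n (1 - V)⁻¹ ≤ coeff n (1 + W) := by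
  have hP : (1 - V)⁻¹ = 1 + V * (1 - V)⁻¹ := by
    linear_combination one_sub_mul_inv_of_le hV0 hV
  have hY : 1 + W = 1 + C (s ^ 2) * X + X * W * (1 + W) := by
    linear_combination h.eqn
  have hs : ∀ n, 0 ≤ coeff n (C (s ^ 2) * X : PowerSeries ℝ) := fun n => by
    rw [coeff_C_mul, coeff_X]
    split_ifs <;> positivity
  have h1 : ∀ n, 0 ≤ coeff n (1 : PowerSeries ℝ) := fun n => by
    rw [coeff_one]
    split_ifs <;> norm_num
  induction n using Nat.strong_induction_on with
  | _ n ih =>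
    have key : ∀ p ∈ Finset.HasAntidiagonal.antidiagonal n,
        0 ≤ coeff p.1 V * coeff p.2 (1 - V)⁻¹ ∧
        coeff p.1 V * coeff p.2 (1 - V)⁻¹ ≤ coeff p.1 (X * W) * coeff p.2 (1 + W) := by
      rintro ⟨i, j⟩ hp
      rw [Finset.HasAntidiagonal.mem_antidiagonal] at hp
      rcases Nat.eq_zero_or_pos i with rfl | hi
      · have e := constantCoeff_eq_zero_of_le hV0 hV
        rw [← coeff_zero_eq_constantCoeff_apply] at e
        simp [e]
      · obtain ⟨h2, h3⟩ := ih j (by simp only at hp; omega)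
        exact ⟨mul_nonneg (hV0 i) h2, mul_le_mul (hV i) h3 h2 ((hV0 i).trans (hV i))⟩
    rw [hP, hY, map_add, map_add, map_add, coeff_mul n V, coeff_mul n (X * W)]
    have h2 := Finset.sum_nonneg fun p hp => (key p hp).1
    have h3 := Finset.sum_le_sum fun p hp => (key p hp).2
    exact ⟨add_nonneg (h1 n) h2, by linarith [hs n]⟩

/-- Squaring the bound P ≤ 1 + W, the equation for W turns W² into a shift of W: for n ≥ 1 the
coefficient of (1+W)² is w_n + w_{n+1}. At n = 0 the hypothesis s ≥ 1 absorbs the constant term. -/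
theorem coeff_inv_sq_mem (n : ℕ) :
    0 ≤ coeff n ((1 - V)⁻¹ ^ 2) ∧ coeff n ((1 - V)⁻¹ ^ 2) ≤ dominant s W n := by
  have hmem := h.coeff_inv_mem hV0 hV
  rw [sq, coeff_mul]
  refine ⟨Finset.sum_nonneg fun p _ => mul_nonneg (hmem _).1 (hmem _).1, ?_⟩
  have h1 : ∑ p ∈ Finset.HasAntidiagonal.antidiagonal n,
      coeff p.1 (1 - V)⁻¹ * coeff p.2 (1 - V)⁻¹ ≤ coeff n ((1 + W) * (1 + W)) := by
    rw [coeff_mul]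
    exact Finset.sum_le_sum fun p _ => mul_le_mul (hmem _).2 (hmem _).2 (hmem _).1
      ((hmem _).1.trans (hmem _).2)
  refine h1.trans ((?_ : _ ≤ _).trans (h.add_coeff_le_dominant n))
  have e : (1 + W) * (1 + W) = 1 + W + W + W ^ 2 := by ring
  rw [e, map_add, map_add, map_add, h.coeff_succ, coeff_one]
  have := one_le_pow₀ h.one_le (n := 2)
  split_ifs <;> linarith

/-- The coefficients of `1 / (1 - V)`, compared with those of `W`, when `V` is dominated by
`X W` and differs from it in finitely many coefficients. -/
theorem tendsto_coeff_inv_div {r v : ℝ} (hr : r = (1 + 2 * s)⁻¹) (hv : SumsTo r V v)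
    (hVe : ∀ᶠ n in atTop, coeff n V = coeff n (X * W)) :
    Tendsto (fun n => coeff n (1 - V)⁻¹ / coeff n W) atTop (nhds (r / (1 - v) ^ 2)) := by
  have hs := h.one_le
  have hr0 : 0 < r := by rw [hr]; positivity
  have hdp := h.dominant_pos
  set P := (1 - V)⁻¹
  have hmem := h.coeff_inv_mem hV0 hV
  have hmem2 := h.coeff_inv_sq_mem hV0 hV
  have hsumP : Summable fun n => coeff n P * r ^ n := by
    have h1 := ((SumsTo.of_one r).add (h.sumsTo hr)).1.of_norm
    refine Summable.of_nonneg_of_le (fun n => ?_) (fun n => ?_) h1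
    · have := (hmem n).1
      positivity
    · exact mul_le_mul_of_nonneg_right (hmem n).2 (by positivity)
  have hP : SumsTo r P (∑' n, coeff n P * r ^ n) := ⟨hsumP.norm, rfl⟩
  set p := ∑' n, coeff n P * r ^ n
  have hp : (1 - v) * p = 1 := by
    have h1 := ((SumsTo.of_one r).sub hv).mul hP
    rw [one_sub_mul_inv_of_le hV0 hV] at h1
    exact h1.unique (SumsTo.of_one r)
  have hsq : ∑' n, coeff n (P ^ 2) * r ^ n = p ^ 2 := by
    rw [sq, sq]
    exact (hP.mul hP).2
  -- Eventually V_{n+1} = w_n, so V_n/d_n has limit (1/(4s))/(1+2s).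
  have hshift : Tendsto (fun n => coeff n V * r ^ n / (dominant s W n * r ^ n)) atTop
      (nhds (r / (4 * s))) := by
    rw [← tendsto_add_atTop_iff_nat 1]
    have h1 := (h.tendsto_coeff_div_dominant.div h.tendsto_dominant_succ_div (by positivity))
    have e : 1 / (4 * s) / (1 + 2 * s) = r / (4 * s) := by rw [hr]; field_simp
    rw [e] at h1
    refine h1.congr' ?_
    filter_upwards [(tendsto_add_atTop_nat 1).eventually hVe] with n hn
    have := (hdp n).ne'
    have := (hdp (n + 1)).ne'
    rw [hn, coeff_succ_X_mul]
    simp only [Pi.div_apply]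
    field_simp
  -- Differentiating P trades the implicit equation P = 1 + VP for an explicit convolution of P²
  -- with jV_j.
  have hder : X * derivative ℝ P = P ^ 2 * (X * derivative ℝ V) := by
    have h1 : derivative ℝ P = -P ^ 2 * derivative ℝ (1 - V) := derivative_inv' _
    rw [h1, map_sub, derivative_one]
    ring
  have hconv := tendsto_weighted_convolution (a := fun n => coeff n (P ^ 2) * r ^ n)
    (b := fun n => coeff n V * r ^ n) (c := fun n => dominant s W n * r ^ n) (A := 1) (B := 1)
    (fun n => mul_pos (hdp n) (by positivity)) (h.summable_dominant hr)
    (h.tendsto_normalized_succ_div hr) (h.normalized_le hr)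
    (fun n => by
      rw [abs_of_nonneg (mul_nonneg (hmem2 n).1 (by positivity)), one_mul]
      exact mul_le_mul_of_nonneg_right (hmem2 n).2 (by positivity))
    (fun n => by
      rw [abs_of_nonneg (mul_nonneg (hV0 n) (by positivity)), one_mul]
      exact mul_le_mul_of_nonneg_right
        ((hV n).trans ((h.coeff_X_mul_le n).trans (h.coeff_le_dominant n))) (by positivity))
    hshift
  rw [hsq] at hconv
  have h2 := hconv.div h.tendsto_coeff_div_dominant (by positivity)
  have e : r / (4 * s) * p ^ 2 / (1 / (4 * s)) = r / (1 - v) ^ 2 := by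
    have h1 : 1 - v ≠ 0 := left_ne_zero_of_mul_eq_one hp
    have h3 : p = 1 / (1 - v) := by rw [eq_div_iff h1, mul_comm, hp]
    rw [h3]
    field_simp
  rw [e] at h2
  refine h2.congr' ?_
  filter_upwards [eventually_gt_atTop 0] with n hn
  obtain ⟨k, rfl⟩ := Nat.exists_eq_succ_of_ne_zero hn.ne'
  have hn0 : ((k + 1 : ℕ) : ℝ) ≠ 0 := by positivity
  have h3 : ∑ q ∈ Finset.HasAntidiagonal.antidiagonal (k + 1),
      coeff q.1 (P ^ 2) * r ^ q.1 * (q.2 * (coeff q.2 V * r ^ q.2)) =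
      (k + 1 : ℕ) * coeff (k + 1) P * r ^ (k + 1) := by
    rw [← coeff_X_mul_derivative, hder, coeff_mul, Finset.sum_mul]
    refine Finset.sum_congr rfl fun q hq => ?_
    rw [coeff_X_mul_derivative, ← Finset.HasAntidiagonal.mem_antidiagonal.1 hq, pow_add]
    ring
  have := (hdp (k + 1)).ne'
  have := (h.coeff_succ_pos k).ne'
  simp only [Pi.div_apply, Nat.succ_eq_add_one]
  rw [h3]
  field_simp

end PowerSeries.IsWffSeries

/-! ### The two inverses in the closed forms -/

namespace PowerSeries.IsWffSeries

variable {s : ℝ} {W : PowerSeries ℝ} (h : IsWffSeries s W)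
include h

theorem tendsto_coeff_div_succ {r : ℝ} (hr : r = (1 + 2 * s)⁻¹) :
    Tendsto (fun n => coeff n W / coeff (n + 1) W) atTop (nhds r) := by
  have hs := h.one_le
  have h1 := h.tendsto_coeff_div_dominant.div h.tendsto_coeff_succ_div_dominant (by positivity)
  have e : 1 / (4 * s) / ((1 + 2 * s) / (4 * s)) = r := by rw [hr]; field_simp
  rw [e] at h1
  refine h1.congr fun n => ?_
  have := (h.dominant_pos n).ne'
  have := (h.coeff_succ_pos n).ne'
  simp only [Pi.div_apply]
  field_simp

theorem tendsto_X_mul {r x : ℝ} (hr : r = (1 + 2 * s)⁻¹) {A : PowerSeries ℝ}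
    (hA : Tendsto (fun n => coeff n A / coeff n W) atTop (nhds x)) :
    Tendsto (fun n => coeff n (X * A) / coeff n W) atTop (nhds (r * x)) := by
  rw [← tendsto_add_atTop_iff_nat 1, mul_comm r]
  refine (hA.mul (h.tendsto_coeff_div_succ hr)).congr' ?_
  filter_upwards [eventually_gt_atTop 0] with n hn
  obtain ⟨k, rfl⟩ := Nat.exists_eq_succ_of_ne_zero hn.ne'
  have := (h.coeff_succ_pos k).ne'
  rw [coeff_succ_X_mul]
  simp only [Nat.succ_eq_add_one]
  field_simp

theorem tendsto_coeff_inv_one_sub {r : ℝ} (hr : r = (1 + 2 * s)⁻¹) :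
    Tendsto (fun n => coeff n (1 - X * W)⁻¹ / coeff n W) atTop (nhds (r / (1 - r * s) ^ 2)) := by
  refine h.tendsto_coeff_inv_div (fun n => ?_) (fun n => le_rfl) hr
    ((SumsTo.of_X r).mul (h.sumsTo hr)) (Eventually.of_forall fun n => rfl)
  cases n with
  | zero => rw [coeff_zero_X_mul]
  | succ n => rw [coeff_succ_X_mul]; exact h.nonneg n

theorem tendsto_coeff_inv_one_add {r : ℝ} (hr : r = (1 + 2 * s)⁻¹) :
    Tendsto (fun n => coeff n (1 + X ^ 2 - X * W)⁻¹ / coeff n W) atTop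
      (nhds (r / (1 + r ^ 2 - r * s) ^ 2)) := by
  have hs := h.one_le
  have e : 1 + X ^ 2 - X * W = 1 - (X * W - X * X) := by ring
  have e' : 1 + r ^ 2 - r * s = 1 - (r * s - r * r) := by ring
  rw [e, e']
  have hX0 : ∀ n, 0 ≤ coeff n (X : PowerSeries ℝ) := fun n => by
    rw [coeff_X]; split_ifs <;> norm_num
  refine h.tendsto_coeff_inv_div (fun n => ?_) (fun n => ?_) hr
    (((SumsTo.of_X r).mul (h.sumsTo hr)).sub ((SumsTo.of_X r).mul (SumsTo.of_X r))) ?_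
  · cases n with
    | zero => simp
    | succ n =>
      rw [map_sub, coeff_succ_X_mul, coeff_succ_X_mul, coeff_X]
      -- Only the coefficient of X² is at stake: there XW contributes w₁ ≥ s² ≥ 1, enough to pay for
      -- the subtracted X².
      split_ifs with hn
      · have := h.coeff_succ 0
        rw [if_pos rfl, h.coeff_zero] at this
        have := h.coeff_sq_nonneg 0
        have := one_le_pow₀ h.one_le (n := 2)
        subst hn
        linarith
      · rw [sub_zero]; exact h.nonneg n
  · cases n with
    | zero => simp
    | succ n =>
      rw [map_sub, coeff_succ_X_mul, coeff_succ_X_mul]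
      linarith [hX0 n]
  · filter_upwards [eventually_gt_atTop 2] with n hn
    obtain ⟨k, rfl⟩ := Nat.exists_eq_succ_of_ne_zero (by omega : n ≠ 0)
    rw [map_sub, coeff_succ_X_mul, coeff_succ_X_mul, coeff_X, if_neg (by omega), sub_zero]

end PowerSeries.IsWffSeries

/-! ### The limiting densities -/

namespace Wff

theorem isWffSeries (V : Type*) [Finite V] [Nonempty V] :
    PowerSeries.IsWffSeries √(Nat.card V : ℝ) (genFun (Set.univ : Set (Wff V))) where
  one_le := by
    rw [Real.one_le_sqrt]
    exact_mod_cast Nat.card_pos (α := V)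
  eqn := by
    rw [Real.sq_sqrt (Nat.cast_nonneg _), map_natCast]
    exact genFun_univ
  nonneg := coeff_genFun_nonneg _

theorem hasDensity_simpleFirstStrict (V : Type*) [Finite V] [Nonempty V] :
    HasDensity (simpleFirstStrict V) (densityFirstStrict (Nat.card V)) := by
  have h := isWffSeries V
  obtain ⟨r, hr⟩ : ∃ r : ℝ, r = (1 + 2 * √(Nat.card V : ℝ))⁻¹ := ⟨_, rfl⟩
  have hm : (Nat.card V : ℝ) = √(Nat.card V : ℝ) ^ 2 := (Real.sq_sqrt (Nat.cast_nonneg _)).symm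
  have hs := h.one_le
  have h1 := (h.tendsto_X_mul hr (h.tendsto_X_mul hr (h.tendsto_X_mul hr
    (h.tendsto_coeff_inv_one_add hr)))).const_mul (Nat.card V : ℝ)
  unfold HasDensity densityFirstStrict
  set s := √(Nat.card V : ℝ)
  have e : (Nat.card V : ℝ) * (r * (r * (r * (r / (1 + r ^ 2 - r * s) ^ 2)))) =
      (Nat.card V : ℝ) / (2 * (Nat.card V : ℝ) + 3 * s + 2) ^ 2 := by
    rw [hm, hr]
    have e1 : 1 + ((1 + 2 * s)⁻¹) ^ 2 - (1 + 2 * s)⁻¹ * s =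
        (2 * s ^ 2 + 3 * s + 2) / (1 + 2 * s) ^ 2 := by field_simp; ring
    have : 2 * s ^ 2 + 3 * s + 2 ≠ 0 := by positivity
    rw [e1]
    field_simp
  rw [e] at h1
  refine h1.congr fun n => ?_
  rw [genFun_simpleFirstStrict, mul_assoc, ← map_natCast (PowerSeries.C (R := ℝ)),
    PowerSeries.coeff_C_mul, pow_succ' _ 2, pow_two PowerSeries.X, mul_assoc, mul_assoc,
    mul_div_assoc]

theorem hasDensity_simpleFirst (V : Type*) [Finite V] [Nonempty V] :
    HasDensity (simpleFirst V) (densityFirst (Nat.card V)) := by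
  have h := isWffSeries V
  obtain ⟨r, hr⟩ : ∃ r : ℝ, r = (1 + 2 * √(Nat.card V : ℝ))⁻¹ := ⟨_, rfl⟩
  have hm : (Nat.card V : ℝ) = √(Nat.card V : ℝ) ^ 2 := (Real.sq_sqrt (Nat.cast_nonneg _)).symm
  have hs := h.one_le
  have h1 := ((h.tendsto_X_mul hr (h.tendsto_coeff_inv_one_sub hr)).sub (h.tendsto_X_mul hr
    (h.tendsto_coeff_inv_one_add hr))).const_mul (Nat.card V : ℝ)
  unfold HasDensity densityFirst
  set s := √(Nat.card V : ℝ)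
  have e : (Nat.card V : ℝ) * (r * (r / (1 - r * s) ^ 2) - r * (r / (1 + r ^ 2 - r * s) ^ 2)) =
      (Nat.card V : ℝ) * (4 * (Nat.card V : ℝ) + 6 * s + 3) /
        ((s + 1) ^ 2 * (2 * (Nat.card V : ℝ) + 3 * s + 2) ^ 2) := by
    rw [hm, hr]
    have e1 : 1 + ((1 + 2 * s)⁻¹) ^ 2 - (1 + 2 * s)⁻¹ * s =
        (2 * s ^ 2 + 3 * s + 2) / (1 + 2 * s) ^ 2 := by field_simp; ring
    have e2 : 1 - (1 + 2 * s)⁻¹ * s = (s + 1) / (1 + 2 * s) := by field_simp; ring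
    have : 2 * s ^ 2 + 3 * s + 2 ≠ 0 := by positivity
    rw [e1, e2]
    field_simp
    ring
  rw [e] at h1
  refine h1.congr fun n => ?_
  rw [genFun_simpleFirst_eq_sub, ← map_natCast (PowerSeries.C (R := ℝ)),
    PowerSeries.coeff_C_mul, mul_sub PowerSeries.X, map_sub, mul_div_assoc, sub_div]

end Wff

/-! ### Expansions for many variables -/

/-- In s = √m the differences become rational functions, and the error scale m²√m becomes s⁵. -/
theorem isBigO_sqrt_of_forall {f : ℕ → ℝ} {g : ℝ → ℝ} {K : ℝ}
    (hfg : ∀ m : ℕ, 1 ≤ m → f m = g √(m : ℝ)) (hg : ∀ s, 1 ≤ s → |g s| ≤ K / s ^ 5) :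
    f =O[atTop] fun m : ℕ => 1 / ((m : ℝ) ^ 2 * √(m : ℝ)) := by
  refine IsBigO.of_bound K ?_
  filter_upwards [eventually_ge_atTop 1] with m hm
  have hs : 1 ≤ √(m : ℝ) := by rw [Real.one_le_sqrt]; exact_mod_cast hm
  have e : (m : ℝ) ^ 2 * √(m : ℝ) = √(m : ℝ) ^ 5 := by
    nth_rewrite 1 [← Real.sq_sqrt (Nat.cast_nonneg (α := ℝ) m)]
    ring
  rw [hfg m hm, e, Real.norm_eq_abs, Real.norm_eq_abs,
    abs_of_nonneg (by positivity : 0 ≤ 1 / √(m : ℝ) ^ 5),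
    mul_one_div]
  exact hg _ hs

theorem densityFirst_isBigO : (fun m : ℕ => densityFirst m
    - (1 / (m : ℝ) - 7 / (2 * m * √(m : ℝ)) + 7 / (m : ℝ) ^ 2))
      =O[atTop] fun m : ℕ => 1 / ((m : ℝ) ^ 2 * √(m : ℝ)) := by
  refine isBigO_sqrt_of_forall (K := 1738) (g := fun s =>
    -((81 * s ^ 5 + 314 * s ^ 4 + 537 * s ^ 3 + 498 * s ^ 2 + 252 * s + 56) /
      (2 * s ^ 4 * ((s + 1) ^ 2 * (2 * s ^ 2 + 3 * s + 2) ^ 2)))) (fun m hm => ?_) fun s hs => ?_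
  · have hs : 1 ≤ √(m : ℝ) := by rw [Real.one_le_sqrt]; exact_mod_cast hm
    have e := Real.sq_sqrt (Nat.cast_nonneg (α := ℝ) m)
    unfold densityFirst
    generalize √(m : ℝ) = s at *
    rw [← e]
    have : 2 * s ^ 2 + 3 * s + 2 ≠ 0 := by positivity
    field_simp
    ring
  · have hs0 : 0 < s := by linarith
    rw [abs_neg, abs_of_nonneg (by positivity), div_le_div_iff₀ (by positivity) (by positivity)]
    -- The constant 1738 is the sum of the coefficients, since every power of s is at most s⁵ for s
    -- ≥ 1.
    have h1 : 81 * s ^ 5 + 314 * s ^ 4 + 537 * s ^ 3 + 498 * s ^ 2 + 252 * s + 56 ≤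
        1738 * s ^ 5 := by
      have p4 : s ^ 4 ≤ s ^ 5 := pow_le_pow_right₀ hs (by norm_num)
      have p3 : s ^ 3 ≤ s ^ 5 := pow_le_pow_right₀ hs (by norm_num)
      have p2 : s ^ 2 ≤ s ^ 5 := pow_le_pow_right₀ hs (by norm_num)
      have p1 : s ≤ s ^ 5 := le_self_pow₀ hs (by norm_num)
      have p0 : 1 ≤ s ^ 5 := one_le_pow₀ hs
      linarith
    have h2 : s ^ 10 ≤ 2 * s ^ 4 * ((s + 1) ^ 2 * (2 * s ^ 2 + 3 * s + 2) ^ 2) := by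
      calc s ^ 10 = 1 * s ^ 4 * (s ^ 2 * (s ^ 2) ^ 2) := by ring
        _ ≤ _ := by gcongr <;> nlinarith
    calc _ ≤ 1738 * s ^ 5 * s ^ 5 := by gcongr
      _ = 1738 * s ^ 10 := by ring
      _ ≤ _ := by gcongr

theorem densityFirstStrict_isBigO : (fun m : ℕ => densityFirstStrict m
    - (1 / (4 * (m : ℝ)) - 3 / (4 * m * √(m : ℝ)) + 19 / (16 * (m : ℝ) ^ 2)))
      =O[atTop] fun m : ℕ => 1 / ((m : ℝ) ^ 2 * √(m : ℝ)) := by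
  refine isBigO_sqrt_of_forall (K := 523) (g := fun s =>
    -((72 * s ^ 3 + 195 * s ^ 2 + 180 * s + 76) /
      (16 * s ^ 4 * (2 * s ^ 2 + 3 * s + 2) ^ 2))) (fun m hm => ?_) fun s hs => ?_
  · have hs : 1 ≤ √(m : ℝ) := by rw [Real.one_le_sqrt]; exact_mod_cast hm
    have e := Real.sq_sqrt (Nat.cast_nonneg (α := ℝ) m)
    unfold densityFirstStrict
    generalize √(m : ℝ) = s at *
    rw [← e]
    have : 2 * s ^ 2 + 3 * s + 2 ≠ 0 := by positivity
    field_simp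
    ring
  · have hs0 : 0 < s := by linarith
    rw [abs_neg, abs_of_nonneg (by positivity), div_le_div_iff₀ (by positivity) (by positivity)]
    -- Again 523 is the sum of the coefficients.
    have h1 : 72 * s ^ 3 + 195 * s ^ 2 + 180 * s + 76 ≤ 523 * s ^ 3 := by
      have p2 : s ^ 2 ≤ s ^ 3 := pow_le_pow_right₀ hs (by norm_num)
      have p1 : s ≤ s ^ 3 := le_self_pow₀ hs (by norm_num)
      have p0 : 1 ≤ s ^ 3 := one_le_pow₀ hs
      linarith
    have h2 : s ^ 8 ≤ 16 * s ^ 4 * (2 * s ^ 2 + 3 * s + 2) ^ 2 := by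
      calc s ^ 8 = 1 * s ^ 4 * (s ^ 2) ^ 2 := by ring
        _ ≤ _ := by gcongr <;> nlinarith
    calc _ ≤ 523 * s ^ 3 * s ^ 5 := by gcongr
      _ = 523 * s ^ 8 := by ring
      _ ≤ _ := by gcongr

theorem proposition5p8 :
    -- the generating functions, as formal power series in `z = PowerSeries.X`
    (∀ (V : Type u) [Finite V] (m : ℕ) (z W : PowerSeries ℝ), Nat.card V = m →
      z = PowerSeries.X → W = Wff.genFun (Set.univ : Set (Wff V)) →
      Wff.genFun (Wff.simpleFirst V)
          = (m : PowerSeries ℝ) * z ^ 3 * ((1 + z ^ 2 - z * W) * (1 - z * W))⁻¹ ∧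
      Wff.genFun (Wff.simpleFirstStrict V)
          = (m : PowerSeries ℝ) * z ^ 3 * (1 + z ^ 2 - z * W)⁻¹) ∧
    -- the limiting densities
    (∀ (V : Type u) [Finite V] [Nonempty V] (m : ℕ), Nat.card V = m →
      Wff.HasDensity (Wff.simpleFirst V) (densityFirst m) ∧
      Wff.HasDensity (Wff.simpleFirstStrict V) (densityFirstStrict m)) ∧
    -- their expansions as the number of variables tends to infinity
    ((fun m : ℕ => densityFirst m
        - (1 / (m : ℝ) - 7 / (2 * m * √(m : ℝ)) + 7 / (m : ℝ) ^ 2))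
      =O[atTop] fun m : ℕ => 1 / ((m : ℝ) ^ 2 * √(m : ℝ))) ∧
    ((fun m : ℕ => densityFirstStrict m
        - (1 / (4 * (m : ℝ)) - 3 / (4 * m * √(m : ℝ)) + 19 / (16 * (m : ℝ) ^ 2)))
      =O[atTop] fun m : ℕ => 1 / ((m : ℝ) ^ 2 * √(m : ℝ))) := by
  refine ⟨?_, ?_, densityFirst_isBigO, densityFirstStrict_isBigO⟩
  · rintro V _ m z W rfl rfl rfl
    exact ⟨Wff.genFun_simpleFirst, Wff.genFun_simpleFirstStrict⟩
  · rintro V _ _ m rfl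
    exact ⟨Wff.hasDensity_simpleFirst V, Wff.hasDensity_simpleFirstStrict V⟩
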